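/- **Setting.** There are $m$ items and $n$ bidders. A valuation is a function $v:2^{[m]}\to[0,\infty)$ with $v(\emptyset)=0$ and $v(S)\le v(T)$ whenever $S\subseteq T$; it is submodular if $v(S\cup T)\le v(S)+v(T)-v(S\cap T)$ for all $S,T\subseteq[m]$. An allocation is a family $S=(S_i)_{i\in[n]}$ of pairwise disjoint subsets of $[m]$ (items may stay unallocated), and its welfare under $v=(v_1,\dots,v_n)$ is $\sum_i v_i(S_i)$. For a set $D\subseteq\mathbb R$ let $\mathcal F_D$ be the class of submodular valuations with values in $D$ (so $D=[0,\infty)$ gives all submodular valuations, and a finite $D$ gives valuations of bounded precision). A (deterministic) mechanism on $\mathcal F_D$, in the communication model, is a finite decision tree: at each internal node one bidder $i$ is asked an arbitrary yes/no question about $v_i$ and transmits the one-bit answer, which determines the next node; each leaf is labelled with an allocation and a vector of nonnegative prices, which are the output. The communication on a profile $v\in\mathcal F_D^n$ is the number of bits transmitted. The mechanism is VCG-based (maximal-in-range) if there is a fixed set $\mathcal H$ of allocations such that for every profile $v\in\mathcal F_D^n$ the allocation that is output belongs to $\mathcal H$ and maximizes $\sum_i v_i(S_i)$ over all $S\in\mathcal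 H$. It has approximation ratio $\alpha$ if for every profile $v\in\mathcal F_D^n$ and every allocation $S$, $\sum_i v_i(S_i)\le\alpha\sum_i v_i(T_i)$, where $T$ is the allocation that is output on $v$. **Theorem.** For every $\varepsilon>0$ and every $C>1$ there is $m_0=m_0(\varepsilon,C)$ such that the following holds for all $m\ge m_0$, all $n\ge C\,m^{\frac13-\varepsilon}$ and every $D\subseteq\mathbb R$ with $\{0,1,\dots,m\}\subseteq D$. Every VCG-based mechanism for $m$ items and $n$ bidders with valuations in $\mathcal F_D$ that has approximation ratio $m^{\frac13-\varepsilon}$ uses exponential communication: there is a profile in $\mathcal F_D^n$ on which at least $2^{m^{\varepsilon}}$ bits are transmitted. -/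

import Mathlib

noncomputable section

namespace CombAuction

/-- A valuation over the bundles of `m` items: nonnegative, normalized and nondecreasing. -/
structure IsValuation {m : ℕ} (v : Finset (Fin m) → ℝ) : Prop where
  nonneg : ∀ S, 0 ≤ v S
  normalized : v ∅ = 0
  nondecreasing : ∀ S T, S ⊆ T → v S ≤ v T

/-- Submodularity of a set function. -/
def IsSubmodular {m : ℕ} (v : Finset (Fin m) → ℝ) : Prop :=
  ∀ S T, v (S ∪ T) ≤ v S + v T - v (S ∩ T)

/-- The class of submodular valuations over `m` items all of whose values lie in `D`.
For `D = Set.Ici 0` (or `Set.univ`) these are all the submodular valuations; a finite `D`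
models valuations of bounded precision. -/
def submodularValuations (m : ℕ) (D : Set ℝ) : Set (Finset (Fin m) → ℝ) :=
  {v | IsValuation v ∧ IsSubmodular v ∧ ∀ S, v S ∈ D}

/-- An allocation of `m` items to `n` bidders: pairwise disjoint bundles
(some items may remain unallocated). -/
structure Allocation (n m : ℕ) where
  bundle : Fin n → Finset (Fin m)
  disjoint : ∀ i j, i ≠ j → Disjoint (bundle i) (bundle j)

/-- What a mechanism outputs: an allocation and a nonnegative price for every bidder. -/
structure Outcome (n m : ℕ) where
  alloc : Allocation n m
  price : Fin n → NNReal

/-- Social welfare of an allocation under a profile of valuations. -/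
def welfare {n m : ℕ} (v : Fin n → Finset (Fin m) → ℝ) (S : Allocation n m) : ℝ :=
  ∑ i, v i (S.bundle i)

/-- A deterministic mechanism in the communication model, for `n` bidders whose valuations
come from the class `V`: a decision tree. At an internal node one bidder `i` is asked an
arbitrary yes/no question about his own valuation, and transmits the one-bit answer; the next
step depends on all the bits transmitted so far. At a leaf an outcome is output. (A query with
a longer answer is a succession of such questions to the same bidder.) -/
inductive Mechanism (n m : ℕ) (V : Set (Finset (Fin m) → ℝ)) : Type
  | output (o : Outcome n m) : Mechanism n m V
  | query (i : Fin n) (q : V → Bool) (next : Bool → Mechanism n m V) : Mechanism n m V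

namespace Mechanism

variable {n m : ℕ} {V : Set (Finset (Fin m) → ℝ)}

/-- The outcome of the mechanism on a profile of valuations. -/
def run : Mechanism n m V → (Fin n → V) → Outcome n m
  | output o, _ => o
  | query i q next, v => (next (q (v i))).run v

/-- The number of bits transmitted when the mechanism is run on a profile of valuations. -/
def bits : Mechanism n m V → (Fin n → V) → ℕ
  | output _, _ => 0
  | query i q next, v => (next (q (v i))).bits v + 1

/-- The mechanism is VCG-based (maximal-in-range): there is a fixed bank `H` of allocations
such that on every profile the allocation that is output maximizes the social welfare over all
the allocations in `H`. -/
def IsVCGBased (M : Mechanism n m V) : Prop :=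
  ∃ H : Set (Allocation n m), ∀ v : Fin n → V,
    (M.run v).alloc ∈ H ∧
      ∀ S ∈ H, welfare (fun i => (v i).1) S ≤ welfare (fun i => (v i).1) (M.run v).alloc

/-- The mechanism has approximation ratio `α` w.r.t. `V`: on every profile of valuations from
`V`, the welfare of its allocation is at least `1 / α` times that of any other allocation. -/
def HasApproximationRatio (M : Mechanism n m V) (α : ℝ) : Prop :=
  ∀ (v : Fin n → V) (S : Allocation n m),
    welfare (fun i => (v i).1) S ≤ α * welfare (fun i => (v i).1) (M.run v).alloc

end Mechanism

end CombAuction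

end

/-!
On the profile in which every item `x` is wanted by the single bidder `g x`, a mechanism with
approximation ratio `a = m ^ (1 / 3 - ε)` hands at least `m / a` items to the bidders wanting them.
With `N = ⌈C * a⌉` bidders, this is a factor `C` more than a random labelling of the items
would achieve, for every `g`. View the allocations in the range `H` as partial labellings of the
items by the bidders. If no pair of bidders shattered a set of `2 * m ^ ε` items, a halving argument
on the numbers of shattered sets would extend all the members of `H` to few total labellings,
and by the Chernoff bound few labellings cannot agree that well with every `g`.

So there are two bidders between whom `H` realizes every split of a set `X` of `2 * m ^ ε` items,
and maximality in range forces the mechanism to divide `X` optimally between them. A valuation may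
encode an arbitrary family of half-size subsets of `X` without losing submodularity, and the optimal
division then detects whether one family is contained in another; a fooling set of profiles, one for
each nonempty family, shows that the communication is at least the number of half-size subsets.
-/

namespace CombAuction

open Finset

section Shattering

variable {σ α ι : Type*} {R : σ → α → ι → Prop} {H H' : Set σ} {i j : ι}

/-- Shattering with two given labels. A member `h` of the class `H` is viewed as a partial
labelling of `α` by `ι`, with `R h x i` meaning that `h` labels `x` by `i`. The set `X` is
pair-shattered if every colouring of `X` by the labels `i` and `j` is realized in `H`; the points
outside `X` may be labelled arbitrarily or not at all. -/
def PairShatters (R : σ → α → ι → Prop) (H : Set σ) (i j : ι) (X : Finset α) : Prop :=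
  ∀ Y ⊆ X, ∃ h ∈ H, (∀ x ∈ Y, R h x i) ∧ ∀ x ∈ X, x ∉ Y → R h x j

theorem PairShatters.mono_left {X : Finset α} (h : PairShatters R H i j X) (hH : H ⊆ H') :
    PairShatters R H' i j X := fun Y hY =>
  let ⟨s, hs, hsY⟩ := h Y hY
  ⟨s, hH hs, hsY⟩

theorem PairShatters.mono_right {X X' : Finset α} (h : PairShatters R H i j X) (hX : X' ⊆ X) :
    PairShatters R H i j X' := fun Y hY =>
  let ⟨s, hs, hi, hj⟩ := h Y (hY.trans hX)
  ⟨s, hs, hi, fun x hx => hj x (hX hx)⟩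

theorem pairShatters_empty (hH : H.Nonempty) : PairShatters R H i j ∅ := by
  obtain ⟨h, hh⟩ := hH
  intro Y hY
  obtain rfl := subset_empty.1 hY
  exact ⟨h, hh, by simp⟩

/-- The subclass of the members of `H` that label `x` by `i`. -/
def labelled (R : σ → α → ι → Prop) (H : Set σ) (x : α) (i : ι) : Set σ :=
  {h ∈ H | R h x i}

theorem labelled_subset (R : σ → α → ι → Prop) (H : Set σ) (x : α) (i : ι) :
    labelled R H x i ⊆ H := fun _ h => h.1

theorem PairShatters.notMem_of_labelled_left (hR : ∀ h, Relator.RightUnique (R h)) (hij : i ≠ j)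
    {x : α} {X : Finset α} (hX : PairShatters R (labelled R H x i) i j X) : x ∉ X := by
  intro hx
  obtain ⟨h, hh, -, hj⟩ := hX ∅ (empty_subset X)
  exact hij (hR h hh.2 (hj x hx (notMem_empty x)))

theorem PairShatters.notMem_of_labelled_right (hR : ∀ h, Relator.RightUnique (R h)) (hij : i ≠ j)
    {x : α} {X : Finset α} (hX : PairShatters R (labelled R H x j) i j X) : x ∉ X := by
  intro hx
  obtain ⟨h, hh, hi, -⟩ := hX X subset_rfl
  exact hij (hR h (hi x hx) hh.2)

theorem PairShatters.insert_of_labelled [DecidableEq α] {x : α} {X : Finset α}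
    (hi : PairShatters R (labelled R H x i) i j X) (hj : PairShatters R (labelled R H x j) i j X) :
    PairShatters R H i j (insert x X) := by
  intro Y hY
  by_cases hx : x ∈ Y
  · obtain ⟨h, hh, hhi, hhj⟩ := hi (Y.erase x) (by grind)
    refine ⟨h, hh.1, fun y hy => ?_, fun y hy hyY => hhj y (by grind) (by grind)⟩
    rcases eq_or_ne y x with rfl | hyx
    · exact hh.2
    · exact hhi y (mem_erase.2 ⟨hyx, hy⟩)
  · obtain ⟨h, hh, hhi, hhj⟩ := hj Y (by grind)
    refine ⟨h, hh.1, hhi, fun y hy hyY => ?_⟩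
    rcases eq_or_ne y x with rfl | hyx
    · exact hh.2
    · exact hhj y (by grind) hyY

variable [Fintype α]

open Classical in
/-- The family of the sets that are pair-shattered by `H` with the labels `i` and `j`; the
two-label analogue of `Finset.shatterer`. -/
noncomputable def pairShatterer (R : σ → α → ι → Prop) (H : Set σ) (i j : ι) :
    Finset (Finset α) :=
  {X | PairShatters R H i j X}

theorem mem_pairShatterer {X : Finset α} :
    X ∈ pairShatterer R H i j ↔ PairShatters R H i j X := by
  simp [pairShatterer]

theorem pairShatterer_mono (hH : H ⊆ H') : pairShatterer R H i j ⊆ pairShatterer R H' i j :=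
  fun _ hX => mem_pairShatterer.2 ((mem_pairShatterer.1 hX).mono_left hH)

theorem card_pairShatterer_pos (hH : H.Nonempty) : 0 < #(pairShatterer R H i j) :=
  card_pos.2 ⟨∅, mem_pairShatterer.2 (pairShatters_empty hH)⟩

/-- A set counted twice on the left yields two sets on the right, with and without `x`. -/
theorem card_pairShatterer_labelled_add_le (hR : ∀ h, Relator.RightUnique (R h)) (H : Set σ)
    (x : α) (hij : i ≠ j) :
    #(pairShatterer R (labelled R H x i) i j) + #(pairShatterer R (labelled R H x j) i j) ≤
      #(pairShatterer R H i j) := by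
  classical
  rw [← card_union_add_card_inter,
    ← card_memberSubfamily_add_card_nonMemberSubfamily x (pairShatterer R H i j), add_comm]
  refine Nat.add_le_add (card_le_card fun X hX => ?_) (card_le_card fun X hX => ?_)
  · obtain ⟨hXi, hXj⟩ := mem_inter.1 hX
    rw [mem_pairShatterer] at hXi hXj
    exact mem_memberSubfamily.2 ⟨mem_pairShatterer.2 (hXi.insert_of_labelled hXj),
      hXi.notMem_of_labelled_left hR hij⟩
  · rw [mem_nonMemberSubfamily]
    rcases mem_union.1 hX with hX | hX
    · exact ⟨pairShatterer_mono (labelled_subset R H x i) hX,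
        (mem_pairShatterer.1 hX).notMem_of_labelled_left hR hij⟩
    · exact ⟨pairShatterer_mono (labelled_subset R H x j) hX,
        (mem_pairShatterer.1 hX).notMem_of_labelled_right hR hij⟩

theorem card_filter_card_le_le_pow (α : Type*) [Fintype α] (d : ℕ) :
    #{X : Finset α | #X ≤ d} ≤ (Fintype.card α + 1) ^ d := by
  calc #{X : Finset α | #X ≤ d}
      = ∑ k ∈ range (d + 1), #{X ∈ {X : Finset α | #X ≤ d} | #X = k} :=
        card_eq_sum_card_fiberwise fun X hX => by
          simpa [Nat.lt_succ_iff] using hX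
    _ ≤ ∑ k ∈ range (d + 1), (Fintype.card α) ^ k * 1 ^ (d - k) * d.choose k := by
        refine sum_le_sum fun k hk => ?_
        calc #{X ∈ {X : Finset α | #X ≤ d} | #X = k}
            ≤ #(powersetCard k (univ : Finset α)) :=
              card_le_card fun X hX => mem_powersetCard_univ.2 (mem_filter.1 hX).2
          _ ≤ Fintype.card α ^ k := by
              rw [card_powersetCard, card_univ]
              exact Nat.choose_le_pow _ _
          _ ≤ Fintype.card α ^ k * 1 ^ (d - k) * d.choose k := by
              rw [one_pow, mul_one]
              exact Nat.le_mul_of_pos_right _ (Nat.choose_pos (mem_range_succ_iff.1 hk))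
    _ = (Fintype.card α + 1) ^ d := (add_pow _ _ _).symm

variable [Fintype ι]

/-- The progress measure of the halving argument: the product, over all ordered pairs of distinct
labels, of the numbers of pair-shattered sets. -/
noncomputable def shatterPotential (R : σ → α → ι → Prop) (H : Set σ) : ℕ :=
  ∏ p ∈ (univ : Finset ι).offDiag, #(pairShatterer R H p.1 p.2)

theorem shatterPotential_pos (hH : H.Nonempty) : 0 < shatterPotential R H :=
  prod_pos fun _ _ => card_pairShatterer_pos hH

theorem two_mul_shatterPotential_le (hH : H' ⊆ H) (hij : i ≠ j)
    (h : 2 * #(pairShatterer R H' i j) ≤ #(pairShatterer R H i j)) :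
    2 * shatterPotential R H' ≤ shatterPotential R H := by
  classical
  have hmem : (i, j) ∈ (univ : Finset ι).offDiag := by simpa using hij
  unfold shatterPotential
  rw [← mul_prod_erase _ _ hmem, ← mul_prod_erase _ _ hmem, ← mul_assoc]
  exact Nat.mul_le_mul h (prod_le_prod' fun p _ => card_le_card (pairShatterer_mono hH))

/-- One of the two subclasses loses half of the sets pair-shattered with the labels `i` and `j`;
the one with the smaller potential therefore loses half of the potential. -/
theorem two_mul_shatterPotential_labelled_le (hR : ∀ h, Relator.RightUnique (R h)) (H : Set σ)
    (x : α) (hij : i ≠ j)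
    (hle : shatterPotential R (labelled R H x i) ≤ shatterPotential R (labelled R H x j)) :
    2 * shatterPotential R (labelled R H x i) ≤ shatterPotential R H := by
  have hadd := card_pairShatterer_labelled_add_le hR H x hij
  rcases le_total #(pairShatterer R (labelled R H x i) i j)
    #(pairShatterer R (labelled R H x j) i j) with hcard | hcard
  · exact two_mul_shatterPotential_le (labelled_subset R H x i) hij (by lia)
  · exact (Nat.mul_le_mul_left 2 hle).trans
      (two_mul_shatterPotential_le (labelled_subset R H x j) hij (by lia))

theorem exists_forall_ne_two_mul_shatterPotential_labelled_le [Nonempty ι]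
    (hR : ∀ h, Relator.RightUnique (R h)) (H : Set σ) :
    ∃ f : α → ι, ∀ x i, i ≠ f x →
      2 * shatterPotential R (labelled R H x i) ≤ shatterPotential R H := by
  choose f hf using fun x : α =>
    Finite.exists_max fun i : ι => shatterPotential R (labelled R H x i)
  exact ⟨f, fun x i hi => two_mul_shatterPotential_labelled_le hR H x hi (hf x i)⟩

theorem shatterPotential_le {d : ℕ} (hd : ∀ i j, i ≠ j → ∀ X, PairShatters R H i j X → #X ≤ d) :
    shatterPotential R H ≤ (Fintype.card α + 1) ^ (d * Fintype.card ι ^ 2) := by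
  have hfactor : ∀ p ∈ (univ : Finset ι).offDiag,
      #(pairShatterer R H p.1 p.2) ≤ (Fintype.card α + 1) ^ d := by
    intro p hp
    refine (card_le_card fun X hX => ?_).trans (card_filter_card_le_le_pow α d)
    exact mem_filter.2 ⟨mem_univ X, hd _ _ (mem_offDiag.1 hp).2.2 X (mem_pairShatterer.1 hX)⟩
  refine (prod_le_pow_card _ _ _ hfactor).trans ?_
  rw [← pow_mul]
  refine Nat.pow_le_pow_right (Nat.succ_pos _) (Nat.mul_le_mul_left d ?_)
  rw [offDiag_card, card_univ, sq]
  exact Nat.sub_le _ _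

/-- Halving: a member of `H` not extended by the majority labelling `f` disagrees with `f` at some
point, which places it in a subclass of at most half the potential. -/
theorem exists_extensions_of_shatterPotential_lt [Nonempty ι]
    (hR : ∀ h, Relator.RightUnique (R h)) {k : ℕ} (hH : shatterPotential R H < 2 ^ k) :
    ∃ F : Finset (α → ι), #F ≤ (Fintype.card α * Fintype.card ι + 1) ^ k ∧
      ∀ h ∈ H, ∃ f ∈ F, ∀ x i, R h x i → f x = i := by
  classical
  induction k generalizing H with
  | zero =>
    have hempty : ¬ H.Nonempty := fun hne => by
      have := shatterPotential_pos (R := R) hne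
      lia
    exact ⟨∅, by simp, fun h hh => absurd ⟨h, hh⟩ hempty⟩
  | succ k ih =>
    obtain ⟨f, hf⟩ := exists_forall_ne_two_mul_shatterPotential_labelled_le hR H
    have hrec : ∀ p : α × ι, p.2 ≠ f p.1 → ∃ F : Finset (α → ι),
        #F ≤ (Fintype.card α * Fintype.card ι + 1) ^ k ∧
        ∀ h ∈ labelled R H p.1 p.2, ∃ g ∈ F, ∀ x i, R h x i → g x = i := fun p hp =>
      ih (by have := hf p.1 p.2 hp; lia)
    choose! F hFcard hFext using hrec
    refine ⟨insert f (({p | p.2 ≠ f p.1} : Finset (α × ι)).biUnion F), ?_, fun h hh => ?_⟩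
    · set s := Fintype.card α * Fintype.card ι
      have hunion : #(({p | p.2 ≠ f p.1} : Finset (α × ι)).biUnion F) ≤ s * (s + 1) ^ k := by
        refine (card_biUnion_le_card_mul _ _ _ fun p hp => hFcard p (mem_filter.1 hp).2).trans ?_
        exact Nat.mul_le_mul_right _ ((card_le_univ _).trans_eq (Fintype.card_prod α ι))
      calc _ ≤ s * (s + 1) ^ k + 1 := (card_insert_le _ _).trans (Nat.add_le_add_right hunion 1)
        _ ≤ s * (s + 1) ^ k + (s + 1) ^ k := Nat.add_le_add_left (Nat.one_le_pow _ _ s.succ_pos) _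
        _ = (s + 1) ^ (k + 1) := by ring
    · by_cases hfh : ∀ x i, R h x i → f x = i
      · exact ⟨f, mem_insert_self _ _, hfh⟩
      · push Not at hfh
        obtain ⟨x, i, hxi, hne⟩ := hfh
        obtain ⟨g, hg, hgext⟩ := hFext (x, i) hne.symm h ⟨hh, hxi⟩
        exact ⟨g, mem_insert_of_mem (mem_biUnion.2 ⟨(x, i), by simpa using hne.symm, hg⟩), hgext⟩

theorem exists_extensions_of_card_pairShatters_le [Nonempty ι]
    (hR : ∀ h, Relator.RightUnique (R h)) {d : ℕ} (hd0 : d ≠ 0)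
    (hd : ∀ i j, i ≠ j → ∀ X, PairShatters R H i j X → #X ≤ d) :
    ∃ F : Finset (α → ι), #F ≤ (Fintype.card α * Fintype.card ι + 1) ^
        (d * Fintype.card ι ^ 2 * (Nat.log 2 (Fintype.card α + 1) + 1)) ∧
      ∀ h ∈ H, ∃ f ∈ F, ∀ x i, R h x i → f x = i := by
  refine exists_extensions_of_shatterPotential_lt hR ((shatterPotential_le hd).trans_lt ?_)
  rw [mul_comm (d * _) (Nat.log 2 _ + 1), pow_mul 2]
  exact Nat.pow_lt_pow_left (Nat.lt_pow_succ_log_self one_lt_two _)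
    (mul_ne_zero hd0 (pow_ne_zero 2 (Fintype.card_ne_zero (α := ι))))

end Shattering

section Agreement

open InformationTheory (klFun)

variable {σ α ι : Type*} [Fintype α] [Fintype ι]

theorem sum_pow_card_agreement [DecidableEq α] [DecidableEq ι] {𝕜 : Type*} [CommRing 𝕜]
    (f : α → ι) (c : 𝕜) :
    ∑ g : α → ι, c ^ #{x | f x = g x} = (Fintype.card ι - 1 + c) ^ Fintype.card α := by
  have hpoint (x : α) : ∑ i, (if f x = i then c else 1) = Fintype.card ι - 1 + c := by
    have hterm (i : ι) : (if f x = i then c else 1) = 1 + if f x = i then c - 1 else 0 := by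
      split_ifs <;> ring
    simp only [hterm, sum_add_distrib, sum_ite_eq, mem_univ, if_true, sum_const, card_univ,
      nsmul_one]
    ring
  calc ∑ g : α → ι, c ^ #{x | f x = g x}
      = ∑ g : α → ι, ∏ x, if f x = g x then c else 1 := by simp [prod_ite]
    _ = ∏ x, ∑ i, if f x = i then c else 1 :=
        (Fintype.prod_sum fun x i => if f x = i then c else 1).symm
    _ = (Fintype.card ι - 1 + c) ^ Fintype.card α := by simp [hpoint]

theorem card_pow_mul_rpow_le_of_agreement [DecidableEq ι] (F : Finset (α → ι)) {C t : ℝ}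
    (hC : 1 ≤ C)
    (hF : ∀ g : α → ι, ∃ f ∈ F, t ≤ (#{x | f x = g x} : ℝ)) :
    (Fintype.card ι : ℝ) ^ Fintype.card α * C ^ t ≤
      #F * ((Fintype.card ι : ℝ) - 1 + C) ^ Fintype.card α := by
  classical
  have hcover (g : α → ι) : C ^ t ≤ ∑ f ∈ F, C ^ #{x | f x = g x} := by
    obtain ⟨f, hf, hft⟩ := hF g
    calc C ^ t ≤ C ^ #{x | f x = g x} := by
          rw [← Real.rpow_natCast]
          exact Real.rpow_le_rpow_of_exponent_le hC hft
      _ ≤ ∑ f ∈ F, C ^ #{x | f x = g x} :=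
          single_le_sum (f := fun f : α → ι => C ^ #{x | f x = g x}) (fun _ _ => by positivity) hf
  calc (Fintype.card ι : ℝ) ^ Fintype.card α * C ^ t
      = ∑ _g : α → ι, C ^ t := by simp
    _ ≤ ∑ g : α → ι, ∑ f ∈ F, C ^ #{x | f x = g x} := sum_le_sum fun g _ => hcover g
    _ = ∑ f ∈ F, ∑ g : α → ι, C ^ #{x | f x = g x} := sum_comm
    _ = #F * ((Fintype.card ι : ℝ) - 1 + C) ^ Fintype.card α := by
        simp only [sum_pow_card_agreement, sum_const, nsmul_eq_mul]

/-- The Chernoff bound: a given labelling agrees with a uniformly random one in at least `C` times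
the expected `card α / card ι` points with probability at most
`exp (-(klFun C * (card α / card ι)))`. -/
theorem exp_klFun_mul_le_card_of_agreement [DecidableEq ι] [Nonempty ι] (F : Finset (α → ι))
    {C : ℝ} (hC : 1 ≤ C)
    (hF : ∀ g : α → ι, ∃ f ∈ F,
      C * (Fintype.card α / Fintype.card ι) ≤ (#{x | f x = g x} : ℝ)) :
    Real.exp (klFun C * (Fintype.card α / Fintype.card ι)) ≤ #F := by
  set N : ℝ := (Fintype.card ι : ℝ) with hN
  set μ : ℝ := (Fintype.card α : ℝ) / N with hμ
  have hNpos : 0 < N := by simpa [hN] using Fintype.card_pos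
  have hbase : (N - 1 + C) ^ Fintype.card α ≤ N ^ Fintype.card α * Real.exp ((C - 1) * μ) := by
    have hexp : N - 1 + C ≤ N * Real.exp ((C - 1) / N) := by
      calc N - 1 + C = N * ((C - 1) / N + 1) := by field_simp; ring
        _ ≤ N * Real.exp ((C - 1) / N) := by gcongr; exact Real.add_one_le_exp _
    calc (N - 1 + C) ^ Fintype.card α
        ≤ (N * Real.exp ((C - 1) / N)) ^ Fintype.card α :=
          pow_le_pow_left₀ (by linarith) hexp _
      _ = N ^ Fintype.card α * Real.exp ((C - 1) * μ) := by
          rw [mul_pow, ← Real.exp_nat_mul, hμ]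
          ring_nf
  have hmul : N ^ Fintype.card α * C ^ (C * μ) ≤
      N ^ Fintype.card α * (#F * Real.exp ((C - 1) * μ)) := by
    calc N ^ Fintype.card α * C ^ (C * μ)
        ≤ #F * (N - 1 + C) ^ Fintype.card α := card_pow_mul_rpow_le_of_agreement F hC hF
      _ ≤ #F * (N ^ Fintype.card α * Real.exp ((C - 1) * μ)) := by gcongr
      _ = N ^ Fintype.card α * (#F * Real.exp ((C - 1) * μ)) := by ring
  calc Real.exp (klFun C * μ)
      = C ^ (C * μ) / Real.exp ((C - 1) * μ) := by
        rw [Real.rpow_def_of_pos (by linarith), ← Real.exp_sub, InformationTheory.klFun]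
        ring_nf
    _ ≤ #F := (div_le_iff₀ (Real.exp_pos _)).2 (le_of_mul_le_mul_left hmul (by positivity))

theorem exists_pairShatters_of_agreement [Nonempty ι] {R : σ → α → ι → Prop}
    [∀ h, DecidableRel (R h)] (hR : ∀ h, Relator.RightUnique (R h)) {H : Set σ} {C : ℝ}
    (hC : 1 ≤ C)
    (hH : ∀ g : α → ι, ∃ h ∈ H, C * (Fintype.card α / Fintype.card ι) ≤ (#{x | R h x (g x)} : ℝ))
    {d : ℕ} (hd0 : d ≠ 0)
    (hd : d * Fintype.card ι ^ 2 * (Nat.log 2 (Fintype.card α + 1) + 1) *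
        Real.log (Fintype.card α * Fintype.card ι + 1) <
      klFun C * (Fintype.card α / Fintype.card ι)) :
    ∃ i j, i ≠ j ∧ ∃ X, #X = d ∧ PairShatters R H i j X := by
  classical
  by_contra! hno
  have hsmall (i j) (hij : i ≠ j) (X) (hX : PairShatters R H i j X) : #X ≤ d := by
    by_contra! hcard
    obtain ⟨Y, hYX, hY⟩ := exists_subset_card_eq hcard.le
    exact hno i j hij Y hY (hX.mono_right hYX)
  obtain ⟨F, hFcard, hF⟩ := exists_extensions_of_card_pairShatters_le hR hd0 hsmall
  have hagree (g : α → ι) : ∃ f ∈ F,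
      C * (Fintype.card α / Fintype.card ι) ≤ (#{x | f x = g x} : ℝ) := by
    obtain ⟨h, hh, hhg⟩ := hH g
    obtain ⟨f, hf, hfh⟩ := hF h hh
    exact ⟨f, hf, hhg.trans (Nat.cast_le.2 (card_mono (monotone_filter_right _ fun x _ =>
      hfh x (g x))))⟩
  have hlarge := (exp_klFun_mul_le_card_of_agreement F hC hagree).trans (Nat.cast_le.2 hFcard)
  rw [← Real.le_log_iff_exp_le (by positivity)] at hlarge
  push_cast [Real.log_pow] at hlarge
  exact hd.not_ge hlarge

end Agreement

section HalfSizeValuation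

variable {α : Type*} [DecidableEq α] {X A B S : Finset α} {k : ℕ}

open Classical in
/-- The valuation `min (2 * #(S ∩ X)) (2 * k)`, lowered by one at the bundles that meet `X` in a set
of size `k` outside the family `𝓕`. The slack of `min` at size `k` is large enough for the valuation
to be monotone and submodular whatever `𝓕` is. -/
noncomputable def halfSizeValuation (X : Finset α) (k : ℕ) (𝓕 : Set (Finset α)) (S : Finset α) :
    ℕ :=
  min (2 * #(S ∩ X)) (2 * k) - if #(S ∩ X) = k ∧ S ∩ X ∉ 𝓕 then 1 else 0

theorem halfSizeValuation_empty (X : Finset α) (k : ℕ) (𝓕 : Set (Finset α)) :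
    halfSizeValuation X k 𝓕 ∅ = 0 := by
  simp [halfSizeValuation]

theorem halfSizeValuation_mono (X : Finset α) (k : ℕ) (𝓕 : Set (Finset α)) :
    Monotone (halfSizeValuation X k 𝓕) := by
  intro S T hST
  have hsub : S ∩ X ⊆ T ∩ X := inter_subset_inter_right hST
  rcases (card_le_card hsub).eq_or_lt with hcard | hcard
  · unfold halfSizeValuation
    rw [eq_of_subset_of_card_le hsub hcard.ge]
  · unfold halfSizeValuation
    split_ifs <;> lia

theorem halfSizeValuation_union_add_inter_le (X : Finset α) (k : ℕ) (𝓕 : Set (Finset α))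
    (S T : Finset α) :
    halfSizeValuation X k 𝓕 (S ∪ T) + halfSizeValuation X k 𝓕 (S ∩ T) ≤
      halfSizeValuation X k 𝓕 S + halfSizeValuation X k 𝓕 T := by
  have hunion : (S ∪ T) ∩ X = S ∩ X ∪ T ∩ X := union_inter_distrib_right S T X
  have hinter : S ∩ T ∩ X = S ∩ X ∩ (T ∩ X) := inter_inter_distrib_right S T X
  unfold halfSizeValuation
  rw [hunion, hinter]
  by_cases hST : S ∩ X ⊆ T ∩ X
  · rw [union_eq_right.2 hST, inter_eq_left.2 hST, add_comm]
  by_cases hTS : T ∩ X ⊆ S ∩ X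
  · rw [union_eq_left.2 hTS, inter_eq_right.2 hTS]
  have hcard := card_union_add_card_inter (S ∩ X) (T ∩ X)
  have hS : #(S ∩ X ∩ (T ∩ X)) < #(S ∩ X) :=
    card_lt_card ⟨inter_subset_left, fun h => hST (h.trans inter_subset_right)⟩
  have hT : #(S ∩ X ∩ (T ∩ X)) < #(T ∩ X) :=
    card_lt_card ⟨inter_subset_right, fun h => hTS (h.trans inter_subset_left)⟩
  split_ifs <;> lia

theorem halfSizeValuation_le (X : Finset α) (k : ℕ) (𝓕 : Set (Finset α)) (S : Finset α) :
    halfSizeValuation X k 𝓕 S ≤ 2 * k :=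
  (Nat.sub_le _ _).trans (min_le_right _ _)

theorem two_mul_le_halfSizeValuation_add_one (𝓕 : Set (Finset α)) (hS : k ≤ #(S ∩ X)) :
    2 * k ≤ halfSizeValuation X k 𝓕 S + 1 := by
  unfold halfSizeValuation
  split_ifs <;> lia

theorem two_mul_le_halfSizeValuation_iff {𝓕 : Set (Finset α)} (hk : 0 < k) :
    2 * k ≤ halfSizeValuation X k 𝓕 S ↔ k ≤ #(S ∩ X) ∧ (#(S ∩ X) = k → S ∩ X ∈ 𝓕) := by
  unfold halfSizeValuation
  split_ifs <;> grind

/-- The family handed to the second bidder. Some `Y ⊆ X` satisfies both `Y ∈ 𝓕` and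
`X \ Y ∈ rivalFamily X 𝓖` if and only if some `Y ∈ 𝓕` satisfies `Y ∉ 𝓖`, so that the best split of
`X` detects whether `𝓕` is contained in `𝓖`. -/
def rivalFamily (X : Finset α) (𝓖 : Set (Finset α)) : Set (Finset α) :=
  {Z | X \ Z ∉ 𝓖}

/-- The bundles `A` and `B`, with values given by `u` and `w`, are worth at least as much as every
partition of `X` into two bundles. -/
def IsOptimalSplit {β : Type*} [Add β] [LE β] (X : Finset α) (u w : Finset α → β)
    (A B : Finset α) : Prop :=
  ∀ Y ⊆ X, u Y + w (X \ Y) ≤ u A + w B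

theorem card_inter_eq_of_isOptimalSplit (hk : 0 < k) (hX : #X = 2 * k) (hAB : Disjoint A B)
    {𝓕 𝓖 : Set (Finset α)} {Y : Finset α} (hYX : Y ⊆ X) (hYk : #Y = k) (hY𝓕 : Y ∈ 𝓕) (hY𝓖 : Y ∉ 𝓖)
    (hopt : IsOptimalSplit X (halfSizeValuation X k 𝓕) (halfSizeValuation X k (rivalFamily X 𝓖))
      A B) :
    #(A ∩ X) = k ∧ #(B ∩ X) = k ∧ X \ (B ∩ X) = A ∩ X ∧ A ∩ X ∈ 𝓕 ∧ A ∩ X ∉ 𝓖 := by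
  have hYc : #(X \ Y) = k := by rw [card_sdiff_of_subset hYX]; lia
  have hY : 2 * k ≤ halfSizeValuation X k 𝓕 Y :=
    (two_mul_le_halfSizeValuation_iff hk).2 (by simp [inter_eq_left.2 hYX, hYk, hY𝓕])
  have hXY : 2 * k ≤ halfSizeValuation X k (rivalFamily X 𝓖) (X \ Y) :=
    (two_mul_le_halfSizeValuation_iff hk).2 (by
      simp [inter_eq_left.2 (sdiff_subset (s := X) (t := Y)), hYc, rivalFamily,
        inter_eq_right.2 hYX, hY𝓖])
  have htotal := hopt Y hYX
  have hA := halfSizeValuation_le X k 𝓕 A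
  have hB := halfSizeValuation_le X k (rivalFamily X 𝓖) B
  obtain ⟨hAk, hA𝓕⟩ := (two_mul_le_halfSizeValuation_iff (X := X) (S := A) (𝓕 := 𝓕) hk).1 (by lia)
  obtain ⟨hBk, hB𝓖⟩ := (two_mul_le_halfSizeValuation_iff (X := X) (S := B)
    (𝓕 := rivalFamily X 𝓖) hk).1 (by lia)
  have hdisj : Disjoint (A ∩ X) (B ∩ X) := hAB.mono inter_subset_left inter_subset_left
  have hsub : A ∩ X ⊆ X \ (B ∩ X) := subset_sdiff.2 ⟨inter_subset_right, hdisj⟩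
  have hcard := card_le_card hsub
  rw [card_sdiff_of_subset inter_subset_right] at hcard
  have hAeq : #(A ∩ X) = k := by lia
  have hBeq : #(B ∩ X) = k := by lia
  have hBA : X \ (B ∩ X) = A ∩ X := (eq_of_subset_of_card_le hsub (by
    rw [card_sdiff_of_subset inter_subset_right]; lia)).symm
  exact ⟨hAeq, hBeq, hBA, hA𝓕 hAeq, hBA ▸ hB𝓖 hBeq⟩

/-- If `Y ∈ 𝓕` but `Y ∉ 𝓖`, then the split is worth `4 * k` on the first pair of families; this
forces it to be worth only `4 * k - 2` on the second, where any member of `𝓖` is worth more. -/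
theorem subset_of_isOptimalSplit (hk : 0 < k) (hX : #X = 2 * k) (hAB : Disjoint A B)
    {𝓕 𝓖 : Finset (Finset α)} (h𝓕 : 𝓕 ⊆ powersetCard k X) (h𝓖 : 𝓖 ⊆ powersetCard k X)
    (h𝓖_ne : 𝓖.Nonempty)
    (h𝓕𝓖 : IsOptimalSplit X (halfSizeValuation X k 𝓕) (halfSizeValuation X k (rivalFamily X 𝓖))
      A B)
    (h𝓖𝓕 : IsOptimalSplit X (halfSizeValuation X k 𝓖) (halfSizeValuation X k (rivalFamily X 𝓕))
      A B) :
    𝓕 ⊆ 𝓖 := by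
  intro Y hY𝓕
  by_contra hY𝓖
  obtain ⟨hYX, hYk⟩ := mem_powersetCard.1 (h𝓕 hY𝓕)
  obtain ⟨hA, hB, hBA, hA𝓕, hA𝓖⟩ :=
    card_inter_eq_of_isOptimalSplit hk hX hAB hYX hYk hY𝓕 hY𝓖 h𝓕𝓖
  have hA_low : halfSizeValuation X k 𝓖 A < 2 * k := by
    rw [← not_le, two_mul_le_halfSizeValuation_iff hk]
    exact fun h => hA𝓖 (h.2 hA)
  have hB_low : halfSizeValuation X k (rivalFamily X 𝓕) B < 2 * k := by
    rw [← not_le, two_mul_le_halfSizeValuation_iff hk]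
    exact fun h => h.2 hB (by rwa [hBA])
  obtain ⟨Z, hZ𝓖⟩ := h𝓖_ne
  obtain ⟨hZX, hZk⟩ := mem_powersetCard.1 (h𝓖 hZ𝓖)
  have hZ_high : 2 * k ≤ halfSizeValuation X k 𝓖 Z :=
    (two_mul_le_halfSizeValuation_iff hk).2 (by simp [inter_eq_left.2 hZX, hZk, hZ𝓖])
  have hXZ_high : 2 * k ≤ halfSizeValuation X k (rivalFamily X 𝓕) (X \ Z) + 1 :=
    two_mul_le_halfSizeValuation_add_one _ (by
      rw [inter_eq_left.2 sdiff_subset, card_sdiff_of_subset hZX]; lia)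
  have htotal := h𝓖𝓕 Z hZX
  lia

end HalfSizeValuation

section Valuations

variable {m : ℕ}

theorem submodularValuations_mono {D D' : Set ℝ} (hD : D ⊆ D') :
    submodularValuations m D ⊆ submodularValuations m D' :=
  fun _ hv => ⟨hv.1, hv.2.1, fun S => hD (hv.2.2 S)⟩

theorem natCast_mem_submodularValuations {v : Finset (Fin m) → ℕ} (h0 : v ∅ = 0)
    (hmono : Monotone v) (hsub : ∀ S T, v (S ∪ T) + v (S ∩ T) ≤ v S + v T) (hle : ∀ S, v S ≤ m) :
    (fun S => (v S : ℝ)) ∈ submodularValuations m (Nat.cast '' Set.Iic m) := by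
  refine ⟨⟨fun S => Nat.cast_nonneg _, by simp [h0], fun S T h => Nat.cast_le.2 (hmono h)⟩,
    fun S T => le_sub_iff_add_le.2 ?_, fun S => ⟨v S, hle S, rfl⟩⟩
  beta_reduce
  exact_mod_cast hsub S T

theorem card_inter_mem_submodularValuations (A : Finset (Fin m)) :
    (fun S => (#(S ∩ A) : ℝ)) ∈ submodularValuations m (Nat.cast '' Set.Iic m) := by
  refine natCast_mem_submodularValuations (by simp)
    (fun S T h => card_le_card (inter_subset_inter_right h)) (fun S T => ?_)
    (fun S => card_finset_fin_le _)
  rw [union_inter_distrib_right, inter_inter_distrib_right, card_union_add_card_inter]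

theorem zero_mem_submodularValuations :
    (0 : Finset (Fin m) → ℝ) ∈ submodularValuations m (Nat.cast '' Set.Iic m) := by
  simpa using! card_inter_mem_submodularValuations (∅ : Finset (Fin m))

theorem halfSizeValuation_mem_submodularValuations {X : Finset (Fin m)} {k : ℕ} (hX : #X = 2 * k)
    (𝓕 : Set (Finset (Fin m))) :
    (fun S => (halfSizeValuation X k 𝓕 S : ℝ)) ∈
      submodularValuations m (Nat.cast '' Set.Iic m) :=
  natCast_mem_submodularValuations (halfSizeValuation_empty X k 𝓕) (halfSizeValuation_mono X k 𝓕)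
    (halfSizeValuation_union_add_inter_le X k 𝓕) fun S =>
      (halfSizeValuation_le X k 𝓕 S).trans (hX ▸ card_finset_fin_le X)

end Valuations

section Allocations

variable {n m : ℕ}

namespace Allocation

/-- The allocation `S` gives the item `x` to the bidder `i`. As a relation between items and bidders
this is the partial labelling to which the notion of pair-shattering is applied. -/
abbrev Assigns (S : Allocation n m) (x : Fin m) (i : Fin n) : Prop := x ∈ S.bundle i

theorem assigns_rightUnique (S : Allocation n m) : Relator.RightUnique S.Assigns := by
  intro x i j hi hj
  by_contra hij
  exact Finset.disjoint_left.1 (S.disjoint i j hij) hi hj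

/-- The allocation that gives every item `x` to the bidder `g x`. -/
def ofAssignment (g : Fin m → Fin n) : Allocation n m where
  bundle i := {x | g x = i}
  disjoint _ _ hij := disjoint_filter.2 fun _ _ hi hj => hij (hi.symm.trans hj)

theorem assigns_ofAssignment_iff {g : Fin m → Fin n} {x : Fin m} {i : Fin n} :
    (ofAssignment g).Assigns x i ↔ g x = i := by
  simp [Assigns, ofAssignment]

end Allocation

theorem welfare_card_inter_ofAssignment (g : Fin m → Fin n) (S : Allocation n m) :
    welfare (fun i T => (#(T ∩ (Allocation.ofAssignment g).bundle i) : ℝ)) S =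
      #{x | S.Assigns x (g x)} := by
  have hfiber (i : Fin n) : S.bundle i ∩ (Allocation.ofAssignment g).bundle i =
      {x ∈ ({x | S.Assigns x (g x)} : Finset (Fin m)) | g x = i} := by
    ext x
    simp only [mem_inter, mem_filter, mem_univ, true_and, Allocation.ofAssignment]
    exact and_congr_left fun h => by rw [h]
  rw [welfare, card_eq_sum_card_fiberwise (f := g) (t := univ) fun _ _ => mem_univ _, Nat.cast_sum]
  exact sum_congr rfl fun i _ => by rw [hfiber]

/-- The profile in which bidder `i` has the valuation `u`, bidder `j` has the valuation `w` and all
the other bidders have the valuation `z`. -/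
def pairProfile {V : Type*} (i j : Fin n) (u w z : V) : Fin n → V :=
  Function.update (Function.update (fun _ => z) j w) i u

theorem welfare_pairProfile {V : Set (Finset (Fin m) → ℝ)} {i j : Fin n} (hij : i ≠ j)
    (u w : V) {z : V} (hz : z.1 = 0) (T : Allocation n m) :
    welfare (fun t => (pairProfile i j u w z t).1) T = u.1 (T.bundle i) + w.1 (T.bundle j) := by
  rw [welfare, Fintype.sum_eq_add i j hij]
  · simp [pairProfile, hij.symm]
  · rintro t ⟨hti, htj⟩
    simp [pairProfile, hti, htj, hz]

end Allocations

theorem two_pow_centralBinom_sub_one_lt_card {α : Type*} [DecidableEq α] {X : Finset α} {k : ℕ}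
    (hk : 0 < k) (hX : #X = 2 * k) :
    2 ^ (k.centralBinom - 1) < #((powersetCard k X).powerset.erase ∅) := by
  have hcb := Nat.two_le_centralBinom k hk
  have hpow : 2 ^ k.centralBinom = 2 ^ (k.centralBinom - 1) * 2 := by
    rw [← pow_succ, Nat.sub_add_cancel (by lia)]
  have hone := Nat.one_lt_two_pow (n := k.centralBinom - 1) (by lia)
  rw [card_erase_of_mem (empty_mem_powerset _), card_powerset, card_powersetCard, hX,
    ← Nat.centralBinom_eq_two_mul_choose]
  lia

namespace Mechanism

variable {n m : ℕ} {V : Set (Finset (Fin m) → ℝ)}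

/-- The rectangle property of communication protocols, with pigeonhole over the transcripts: two of
the given profiles have the same transcript, and then so does every profile in which each bidder's
valuation comes from one of the two. -/
theorem exists_run_eq_of_bits_le {τ : Type*} (M : Mechanism n m V) {B : ℕ} {P : Finset τ}
    {v : τ → Fin n → V} (hP : 2 ^ B < #P) (hB : ∀ a ∈ P, M.bits (v a) ≤ B) :
    ∃ a ∈ P, ∃ b ∈ P, a ≠ b ∧ ∃ o, ∀ w : Fin n → V,
      (∀ i, w i = v a i ∨ w i = v b i) → M.run w = o := by
  induction M generalizing B P with
  | output o =>
    obtain ⟨a, ha, b, hb, hab⟩ := one_lt_card.1 (Nat.one_le_two_pow.trans_lt hP)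
    exact ⟨a, ha, b, hb, hab, o, fun w _ => rfl⟩
  | query i q next ih =>
    cases B with
    | zero =>
      obtain ⟨a, ha⟩ := card_pos.1 ((Nat.zero_le _).trans_lt hP)
      exact absurd (hB a ha) (Nat.not_succ_le_zero _)
    | succ B =>
      obtain ⟨c, -, hc⟩ : ∃ c ∈ univ, 2 ^ B < #{a ∈ P | q (v a i) = c} :=
        exists_lt_card_fiber_of_mul_lt_card_of_maps_to (fun _ _ => mem_univ _)
          (by rwa [card_univ, Fintype.card_bool, ← pow_succ'])
      obtain ⟨a, ha, b, hb, hab, o, ho⟩ := ih c hc fun a ha => by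
        obtain ⟨haP, rfl⟩ := mem_filter.1 ha
        exact Nat.le_of_succ_le_succ (hB a haP)
      obtain ⟨haP, hac⟩ := mem_filter.1 ha
      obtain ⟨hbP, hbc⟩ := mem_filter.1 hb
      refine ⟨a, haP, b, hbP, hab, o, fun w hw => ?_⟩
      have hwc : q (w i) = c := by rcases hw i with h | h <;> rw [h] <;> assumption
      simpa only [run, hwc] using ho w hw

theorem isOptimalSplit_run_pairProfile (M : Mechanism n m V) {H : Set (Allocation n m)}
    (hH : ∀ v : Fin n → V, ∀ S ∈ H,
      welfare (fun i => (v i).1) S ≤ welfare (fun i => (v i).1) (M.run v).alloc)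
    {i j : Fin n} (hij : i ≠ j) {X : Finset (Fin m)} (hX : PairShatters Allocation.Assigns H i j X)
    {u w z : V} (hu : Monotone u.1) (hw : Monotone w.1) (hz : z.1 = 0) :
    IsOptimalSplit X u.1 w.1 ((M.run (pairProfile i j u w z)).alloc.bundle i)
      ((M.run (pairProfile i j u w z)).alloc.bundle j) := by
  intro Y hY
  obtain ⟨S, hS, hi, hj⟩ := hX Y hY
  have hmax := hH (pairProfile i j u w z) S hS
  rw [welfare_pairProfile hij u w hz, welfare_pairProfile hij u w hz] at hmax
  refine (add_le_add (hu hi) (hw fun x hx => ?_)).trans hmax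
  exact hj x (mem_sdiff.1 hx).1 (mem_sdiff.1 hx).2

/-- The fooling set consists of the profiles that hand a nonempty family `𝓕` of half-size subsets of
`X` to bidder `i` and its rival family to bidder `j`. -/
theorem exists_centralBinom_le_bits (hV : submodularValuations m (Nat.cast '' Set.Iic m) ⊆ V)
    (M : Mechanism n m V) {H : Set (Allocation n m)}
    (hH : ∀ v : Fin n → V, ∀ S ∈ H,
      welfare (fun i => (v i).1) S ≤ welfare (fun i => (v i).1) (M.run v).alloc)
    {i j : Fin n} (hij : i ≠ j) {X : Finset (Fin m)} {k : ℕ} (hk : 0 < k) (hX : #X = 2 * k)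
    (hsh : PairShatters Allocation.Assigns H i j X) :
    ∃ v, k.centralBinom ≤ M.bits v := by
  by_contra! hbits
  let U (𝓕 : Set (Finset (Fin m))) : V :=
    ⟨_, hV (halfSizeValuation_mem_submodularValuations hX 𝓕)⟩
  let z : V := ⟨0, hV zero_mem_submodularValuations⟩
  obtain ⟨𝓕, h𝓕, 𝓖, h𝓖, hne, o, ho⟩ := M.exists_run_eq_of_bits_le
    (two_pow_centralBinom_sub_one_lt_card hk hX)
    (v := fun 𝓕 : Finset (Finset (Fin m)) => pairProfile i j (U 𝓕) (U (rivalFamily X 𝓕)) z)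
    fun 𝓕 _ => Nat.le_sub_one_of_lt (hbits _)
  have hopt (𝓐 𝓑 : Finset (Finset (Fin m))) (h𝓐 : 𝓐 = 𝓕 ∨ 𝓐 = 𝓖) (h𝓑 : 𝓑 = 𝓕 ∨ 𝓑 = 𝓖) :
      IsOptimalSplit X (halfSizeValuation X k 𝓐) (halfSizeValuation X k (rivalFamily X 𝓑))
        (o.alloc.bundle i) (o.alloc.bundle j) := by
    have hrun : M.run (pairProfile i j (U 𝓐) (U (rivalFamily X 𝓑)) z) = o := by
      refine ho _ fun t => ?_
      simp only [pairProfile, Function.update_apply]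
      grind
    intro Y hY
    have hle := M.isOptimalSplit_run_pairProfile hH hij hsh (u := U 𝓐) (w := U (rivalFamily X 𝓑))
      (z := z) (Nat.mono_cast.comp (halfSizeValuation_mono X k _))
      (Nat.mono_cast.comp (halfSizeValuation_mono X k _)) rfl Y hY
    rw [hrun] at hle
    dsimp only [U] at hle
    exact_mod_cast hle
  obtain ⟨h𝓕_ne, h𝓕_sub⟩ := mem_erase.1 h𝓕
  obtain ⟨h𝓖_ne, h𝓖_sub⟩ := mem_erase.1 h𝓖
  rw [mem_powerset] at h𝓕_sub h𝓖_sub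
  have hdisj := o.alloc.disjoint i j hij
  have h𝓕𝓖 := hopt 𝓕 𝓖 (.inl rfl) (.inr rfl)
  have h𝓖𝓕 := hopt 𝓖 𝓕 (.inr rfl) (.inl rfl)
  exact hne (subset_antisymm
    (subset_of_isOptimalSplit hk hX hdisj h𝓕_sub h𝓖_sub (nonempty_iff_ne_empty.2 h𝓖_ne) h𝓕𝓖 h𝓖𝓕)
    (subset_of_isOptimalSplit hk hX hdisj h𝓖_sub h𝓕_sub (nonempty_iff_ne_empty.2 h𝓕_ne) h𝓖𝓕 h𝓕𝓖))

theorem HasApproximationRatio.exists_le_mul_card_agreement {M : Mechanism n m V} {a : ℝ}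
    (hM : M.HasApproximationRatio a) (hV : submodularValuations m (Nat.cast '' Set.Iic m) ⊆ V)
    (g : Fin m → Fin n) :
    ∃ v, (m : ℝ) ≤ a * #{x | (M.run v).alloc.Assigns x (g x)} := by
  let v (i : Fin n) : V :=
    ⟨_, hV (card_inter_mem_submodularValuations ((Allocation.ofAssignment g).bundle i))⟩
  have hratio := hM v (Allocation.ofAssignment g)
  simp only [v, welfare_card_inter_ofAssignment, Allocation.assigns_ofAssignment_iff] at hratio
  exact ⟨v, by simpa using hratio⟩

theorem HasApproximationRatio.one_le {M : Mechanism n m V} {a : ℝ}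
    (hM : M.HasApproximationRatio a) (hV : submodularValuations m (Nat.cast '' Set.Iic m) ⊆ V)
    (hn : 0 < n) (hm : 0 < m) : 1 ≤ a := by
  obtain ⟨v, hv⟩ := hM.exists_le_mul_card_agreement hV fun _ => ⟨0, hn⟩
  set s : Finset (Fin m) := {x | (M.run v).alloc.Assigns x ⟨0, hn⟩}
  have hs : (#s : ℝ) ≤ m := Nat.cast_le.2 (card_finset_fin_le s)
  have hm' : (0 : ℝ) < m := Nat.cast_pos.2 hm
  by_contra! ha
  rcases le_or_gt a 0 with ha0 | ha0
  · linarith [mul_nonpos_of_nonpos_of_nonneg ha0 (Nat.cast_nonneg (α := ℝ) #s)]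
  · nlinarith

theorem HasApproximationRatio.exists_mul_div_le_card_agreement {M : Mechanism n m V} {a C : ℝ}
    {N : ℕ} (hM : M.HasApproximationRatio a)
    (hV : submodularValuations m (Nat.cast '' Set.Iic m) ⊆ V) (hC : 0 ≤ C) (hN0 : 0 < N)
    (hN : C * a ≤ N) (g : Fin m → Fin n) :
    ∃ v, C * (m / N) ≤ (#{x | (M.run v).alloc.Assigns x (g x)} : ℝ) := by
  obtain ⟨v, hv⟩ := hM.exists_le_mul_card_agreement hV g
  refine ⟨v, ?_⟩
  rw [← mul_div_assoc, div_le_iff₀ (Nat.cast_pos.2 hN0)]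
  set s : ℝ := (#{x | (M.run v).alloc.Assigns x (g x)} : ℝ)
  calc C * m ≤ C * (a * s) := mul_le_mul_of_nonneg_left hv hC
    _ = C * a * s := by ring
    _ ≤ N * s := mul_le_mul_of_nonneg_right hN (Nat.cast_nonneg _)
    _ = s * N := mul_comm _ _

theorem HasApproximationRatio.exists_pairShatters {M : Mechanism n m V} {a C : ℝ} {N d : ℕ}
    (hM : M.HasApproximationRatio a) (hV : submodularValuations m (Nat.cast '' Set.Iic m) ⊆ V)
    {H : Set (Allocation n m)} (hH : ∀ v, (M.run v).alloc ∈ H) (hC : 1 ≤ C) (hN0 : 0 < N)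
    (hNn : N ≤ n) (hN : C * a ≤ N) (hd0 : d ≠ 0)
    (hd : d * (N : ℝ) ^ 2 * (Nat.log 2 (m + 1) + 1) * Real.log (m * N + 1) <
      InformationTheory.klFun C * (m / N)) :
    ∃ i j, i ≠ j ∧ ∃ X, #X = d ∧ PairShatters Allocation.Assigns H i j X := by
  have : NeZero N := ⟨hN0.ne'⟩
  have hinj := Fin.castLE_injective hNn
  obtain ⟨i, j, hij, X, hX, hsh⟩ := exists_pairShatters_of_agreement (H := H)
    (R := fun (S : Allocation n m) x (i : Fin N) => S.Assigns x (Fin.castLE hNn i))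
    (fun S x i j hi hj => hinj (S.assigns_rightUnique hi hj)) hC
    (fun g => by
      obtain ⟨v, hv⟩ := hM.exists_mul_div_le_card_agreement hV (by linarith) hN0 hN
        fun x => Fin.castLE hNn (g x)
      exact ⟨_, hH v, by simpa only [Fintype.card_fin] using hv⟩)
    hd0 (by simpa only [Fintype.card_fin] using hd)
  exact ⟨_, _, hinj.ne hij, X, hX, hsh⟩

end Mechanism

section Asymptotics

open Filter
open InformationTheory (klFun)

theorem klFun_pos {x : ℝ} (hx : 0 ≤ x) (hx1 : x ≠ 1) : 0 < klFun x :=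
  (InformationTheory.klFun_nonneg hx).lt_of_ne'
    fun h => hx1 ((InformationTheory.klFun_eq_zero_iff hx).1 h)

theorem eventually_log_natCast_le_mul_rpow {ε δ : ℝ} (hε : 0 < ε) (hδ : 0 < δ) :
    ∀ᶠ m : ℕ in atTop, Real.log m ≤ δ * (m : ℝ) ^ ε := by
  filter_upwards [tendsto_natCast_atTop_atTop.eventually
    ((isLittleO_log_rpow_atTop hε).bound hδ)] with m hm
  rwa [Real.norm_of_nonneg (Real.log_natCast_nonneg m),
    Real.norm_of_nonneg (Real.rpow_nonneg m.cast_nonneg ε)] at hm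

theorem natLog_two_succ_add_one_le {m : ℕ} (hm : 3 ≤ m) :
    (Nat.log 2 (m + 1) : ℝ) + 1 ≤ 5 * Real.log m := by
  have hm' : (3 : ℝ) ≤ m := by exact_mod_cast hm
  have hlogm : 1 ≤ Real.log m := by
    rw [Real.le_log_iff_exp_le (by linarith)]
    linarith [Real.exp_one_lt_d9]
  have hsucc : Real.log ((m + 1 : ℕ) : ℝ) ≤ 2 * Real.log m := by
    rw [← Real.log_rpow (by linarith)]
    refine Real.log_le_log (by positivity) ?_
    push_cast [Real.rpow_two]
    nlinarith
  have hlog : (Nat.log 2 (m + 1) : ℝ) * Real.log 2 ≤ 2 * Real.log m :=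
    ((le_div_iff₀ (Real.log_pos one_lt_two)).1 (Real.natLog_le_logb (m + 1) 2)).trans hsucc
  nlinarith [Real.log_two_gt_d9, (Nat.log 2 (m + 1)).cast_nonneg (α := ℝ)]

theorem log_mul_add_one_le {C m N : ℝ} (hC : 0 ≤ C) (hm : C + 2 ≤ m) (hN0 : 0 ≤ N)
    (hN : N ≤ (C + 1) * m) : Real.log (m * N + 1) ≤ 3 * Real.log m := by
  have hcube : m * N + 1 ≤ m ^ 3 := by
    have hmN : m * N ≤ m * ((m - 1) * m) := by
      refine mul_le_mul_of_nonneg_left (hN.trans ?_) (by linarith)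
      exact mul_le_mul_of_nonneg_right (by linarith) (by linarith)
    nlinarith
  have hpos : 0 < m * N + 1 := by nlinarith
  exact_mod_cast (Real.log_le_log hpos hcube).trans_eq (Real.log_pow m 3)

theorem shattering_bound_of_log_le {C a b δ c : ℝ} {m N : ℕ} (hC : 0 ≤ C) (hm3 : 3 ≤ m)
    (hmC : C + 2 ≤ m) (ha : 1 ≤ a) (hb : 1 ≤ b) (hab : a ^ 3 * b ^ 3 = m) (hN0 : 0 < N)
    (hN : N ≤ C * a + 1) (hlog : Real.log m ≤ δ * b) (hδ : 60 * (C + 1) ^ 3 * δ ^ 2 < c) :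
    ((2 * ⌈b⌉₊ : ℕ) : ℝ) * N ^ 2 * (Nat.log 2 (m + 1) + 1) * Real.log (m * N + 1) <
      c * (m / N) := by
  have ham : a ≤ m := hab ▸ (le_self_pow₀ ha three_ne_zero).trans
    (le_mul_of_one_le_right (by positivity) (one_le_pow₀ hb))
  have hNa : (N : ℝ) ≤ (C + 1) * a := by linarith
  have hNm : (N : ℝ) ≤ (C + 1) * m := hNa.trans (by gcongr)
  have hceil : ((2 * ⌈b⌉₊ : ℕ) : ℝ) ≤ 4 * b := by
    push_cast
    linarith [Nat.ceil_lt_add_one (zero_le_one.trans hb)]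
  have hnatLog := natLog_two_succ_add_one_le hm3
  have hlogN := log_mul_add_one_le hC hmC N.cast_nonneg hNm
  have hlogN0 : 0 ≤ Real.log (m * N + 1) := Real.log_nonneg (le_add_of_nonneg_left (by positivity))
  rw [← mul_div_assoc, lt_div_iff₀ (Nat.cast_pos.2 hN0)]
  calc ((2 * ⌈b⌉₊ : ℕ) : ℝ) * N ^ 2 * (Nat.log 2 (m + 1) + 1) * Real.log (m * N + 1) * N
      = ((2 * ⌈b⌉₊ : ℕ) : ℝ) * N ^ 3 * ((Nat.log 2 (m + 1) + 1) * Real.log (m * N + 1)) := by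
        ring
    _ ≤ 4 * b * ((C + 1) * a) ^ 3 * (5 * Real.log m * (3 * Real.log m)) := by gcongr
    _ = 60 * (C + 1) ^ 3 * a ^ 3 * b * Real.log m ^ 2 := by ring
    _ ≤ 60 * (C + 1) ^ 3 * a ^ 3 * b * (δ * b) ^ 2 := by gcongr
    _ = 60 * (C + 1) ^ 3 * δ ^ 2 * m := by rw [← hab]; ring
    _ < c * m := by gcongr

theorem eventually_shattering_bound {ε C : ℝ} (hε : 0 < ε) (hC : 1 < C) :
    ∀ᶠ m : ℕ in atTop, 1 ≤ (m : ℝ) ^ ((1 : ℝ) / 3 - ε) →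
      ∀ N : ℕ, 0 < N → N ≤ C * (m : ℝ) ^ ((1 : ℝ) / 3 - ε) + 1 →
        ((2 * ⌈(m : ℝ) ^ ε⌉₊ : ℕ) : ℝ) * N ^ 2 * (Nat.log 2 (m + 1) + 1) *
          Real.log (m * N + 1) < klFun C * (m / N) := by
  have hkl : 0 < klFun C := klFun_pos (by linarith) hC.ne'
  obtain ⟨δ, hδ, hδC⟩ : ∃ δ : ℝ, 0 < δ ∧ 60 * (C + 1) ^ 3 * δ ^ 2 < klFun C := by
    refine ⟨√(klFun C / (2 * (60 * (C + 1) ^ 3))), by positivity, ?_⟩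
    calc 60 * (C + 1) ^ 3 * √(klFun C / (2 * (60 * (C + 1) ^ 3))) ^ 2
        = klFun C / 2 := by rw [Real.sq_sqrt (by positivity)]; field_simp
      _ < klFun C := half_lt_self hkl
  filter_upwards [eventually_log_natCast_le_mul_rpow hε hδ, eventually_ge_atTop 3,
    tendsto_natCast_atTop_atTop.eventually (eventually_ge_atTop (C + 2))] with m hlog hm3 hmC
  intro ha N hN0 hN
  have hm0 : (0 : ℝ) < m := by positivity
  have hb : 1 ≤ (m : ℝ) ^ ε := Real.one_le_rpow (Nat.one_le_cast.2 (by lia)) hε.le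
  have hab : ((m : ℝ) ^ ((1 : ℝ) / 3 - ε)) ^ 3 * ((m : ℝ) ^ ε) ^ 3 = m := by
    rw [← mul_pow, ← Real.rpow_add hm0, ← Real.rpow_natCast, ← Real.rpow_mul hm0.le]
    norm_num
  exact shattering_bound_of_log_le (by linarith) hm3 hmC ha hb hab hN0 hN hlog hδC

theorem two_rpow_le_two_pow_ceil (b : ℝ) : (2 : ℝ) ^ b ≤ 2 ^ ⌈b⌉₊ := by
  rw [← Real.rpow_natCast]
  exact Real.rpow_le_rpow_of_exponent_le one_le_two (Nat.le_ceil b)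

theorem two_pow_le_centralBinom (k : ℕ) : 2 ^ k ≤ k.centralBinom := by
  induction k with
  | zero => simp
  | succ k ih =>
    refine Nat.le_of_mul_le_mul_left ?_ k.succ_pos
    calc (k + 1) * 2 ^ (k + 1) = 2 * (k + 1) * 2 ^ k := by ring
      _ ≤ 2 * (2 * k + 1) * k.centralBinom := Nat.mul_le_mul (by lia) ih
      _ = (k + 1) * (k + 1).centralBinom := (Nat.succ_mul_centralBinom_succ k).symm

end Asymptotics

end CombAuction

open CombAuction in
theorem mainTheorem8_general (ε : ℝ) (hε : 0 < ε) (C : ℝ) (hC : 1 < C) :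
    ∃ m₀ : ℕ, ∀ m n : ℕ, m₀ ≤ m → C * (m : ℝ) ^ ((1 : ℝ) / 3 - ε) ≤ (n : ℝ) →
      ∀ V : Set (Finset (Fin m) → ℝ), submodularValuations m (Nat.cast '' Set.Iic m) ⊆ V →
        ∀ M : Mechanism n m V, M.IsVCGBased →
          M.HasApproximationRatio ((m : ℝ) ^ ((1 : ℝ) / 3 - ε)) →
          ∃ v : Fin n → V, (2 : ℝ) ^ ((m : ℝ) ^ ε) ≤ (M.bits v : ℝ) := by
  obtain ⟨m₁, hm₁⟩ := Filter.eventually_atTop.1 (eventually_shattering_bound hε hC)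
  refine ⟨max m₁ 1, fun m n hm hn V hV M ⟨H, hH⟩ hM => ?_⟩
  obtain ⟨hmm₁, hm1⟩ := max_le_iff.1 hm
  set a := (m : ℝ) ^ ((1 : ℝ) / 3 - ε)
  set k := ⌈(m : ℝ) ^ ε⌉₊
  have hk : 0 < k := by positivity
  have hCa : 0 < C * a := by positivity
  have hN0 : 0 < ⌈C * a⌉₊ := Nat.ceil_pos.2 hCa
  have ha : 1 ≤ a := hM.one_le hV (Nat.cast_pos.1 (hCa.trans_le hn)) hm1
  have hbound := hm₁ m hmm₁ ha ⌈C * a⌉₊ hN0 (Nat.ceil_lt_add_one hCa.le).le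
  obtain ⟨i, j, hij, X, hX, hsh⟩ := hM.exists_pairShatters hV (fun v => (hH v).1) hC.le hN0
    (Nat.ceil_le.2 hn) (Nat.le_ceil _) (by lia) hbound
  obtain ⟨v, hv⟩ := M.exists_centralBinom_le_bits hV (fun v => (hH v).2) hij hk hX hsh
  refine ⟨v, (two_rpow_le_two_pow_ceil _).trans ?_⟩
  exact_mod_cast (two_pow_le_centralBinom k).trans hv

theorem mainTheorem8 (ε : ℝ) (hε : 0 < ε) (C : ℝ) (hC : 1 < C) :
    ∃ m₀ : ℕ, ∀ m n : ℕ, m₀ ≤ m → C * (m : ℝ) ^ ((1 : ℝ) / 3 - ε) ≤ (n : ℝ) →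
      ∀ D : Set ℝ, (∀ k : ℕ, k ≤ m → (k : ℝ) ∈ D) →
        ∀ M : CombAuction.Mechanism n m (CombAuction.submodularValuations m D),
          M.IsVCGBased →
          M.HasApproximationRatio ((m : ℝ) ^ ((1 : ℝ) / 3 - ε)) →
          ∃ v : Fin n → CombAuction.submodularValuations m D,
            (2 : ℝ) ^ ((m : ℝ) ^ ε) ≤ (M.bits v : ℝ) := by
  obtain ⟨m₀, hm₀⟩ := mainTheorem8_general ε hε C hC
  exact ⟨m₀, fun m n hm hn D hD M =>
    hm₀ m n hm hn _ (CombAuction.submodularValuations_mono (Set.image_subset_iff.2 hD)) M⟩
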